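/- Let $N$ players $i=1,\dots,N$ choose Hermitian matrices $X_i$ of size $M_i$ (over $\mathbb{C}$, or real symmetric matrices over $\mathbb{R}$), with feasible sets $$\mathcal{X}_i=\{X_i\succeq 0:\ \|X_i\|\le A_i\},\qquad A_i>0,$$ where $\|X_i\|=\sum_m|\mathrm{eig}_m(X_i)|$ is the nuclear norm, and let $\mathcal{X}=\prod_i\mathcal{X}_i$. Let $u_i:\mathcal{X}\to\mathbb{R}$ be the utility of player $i$. Assume that $u_i(X_i;X_{-i})$ is concave and differentiable in $X_i\in\mathcal{X}_i$ for every fixed $X_{-i}$, and that the individual gradients $V_i(X)=\nabla_{X_i}u_i(X)$ (Hermitian matrices, taken with respect to the trace inner product $\langle A,B\rangle=\mathrm{tr}(AB)$ and within the feasible sets at boundary points) are continuously differentiable on $\mathcal{X}$. A profile $X^*\in\mathcal{X}$ is a Nash equilibrium if $u_i(X^*)\ge u_i(X_i;X^*_{-i})$ for all $i$ and all $X_i\in\mathcal{X}_i$; it is isolated if it is the only Nash equilibrium in some neighbourhood of itself. A profile $X^*\in\mathcal{X}$ is (locally) stable if $$\sum_i \mathrm{tr}\big[(X_i-X_i^*)V_i(X)\big]\le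 0,\quad\text{with equality if and only if } X=X^*,$$ for all $X\in\mathcal{X}$ sufficiently close to $X^*$, and globally stable if this holds for all $X\in\mathcal{X}$. The Hessian of the game is the block matrix $D(X)=(D_{ij}(X))_{i,j}$, $$D_{ij}(X)=\tfrac12\nabla_{X_i}\nabla_{X_j}u_j(X)+\tfrac12\big[\nabla_{X_j}\nabla_{X_i}u_i(X)\big]^\dagger,$$ where $\nabla_{X_i}\nabla_{X_j}u_j=\nabla_{X_i}V_j$ has its rows indexed by the coordinates of $X_i$, and $D(X)\prec0$ means that $\sum_{i,j}\langle H_i,D_{ij}(X)H_j\rangle<0$ for every nonzero tuple $H=(H_1,\dots,H_N)$ of Hermitian matrices $H_i$ of size $M_i$. Then: 1. If $D(X)\prec0$ for all $X\in\mathcal{X}$, the game has a Nash equilibrium, it is unique, and it is globally stable. 2. If $X^*$ is a Nash equilibrium and $D(X^*)\prec 0$, then $X^*$ is locally stable and isolated. -/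

import Mathlib

open scoped Topology InnerProductSpace ComplexOrder

noncomputable section

/-- The real vector space of Hermitian `n × n` matrices over `𝕜 = ℝ` or `𝕜 = ℂ`. -/
def HermMat (𝕜 : Type*) [RCLike 𝕜] (n : Type*) : Type _ :=
  selfAdjoint.submodule ℝ (Matrix n n 𝕜)

namespace HermMat

variable {𝕜 : Type*} [RCLike 𝕜] {n : Type*}

instance : AddCommGroup (HermMat 𝕜 n) :=
  inferInstanceAs (AddCommGroup (selfAdjoint.submodule ℝ (Matrix n n 𝕜)))

instance : Module ℝ (HermMat 𝕜 n) :=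
  inferInstanceAs (Module ℝ (selfAdjoint.submodule ℝ (Matrix n n 𝕜)))

/-- The underlying matrix. -/
def mat (X : HermMat 𝕜 n) : Matrix n n 𝕜 := Subtype.val X

theorem isHermitian (X : HermMat 𝕜 n) : X.mat.IsHermitian := Subtype.property X

theorem ext_mat {X Y : HermMat 𝕜 n} (h : X.mat = Y.mat) : X = Y := Subtype.ext h

theorem mat_add (X Y : HermMat 𝕜 n) : (X + Y).mat = X.mat + Y.mat := rfl

theorem mat_smul (r : ℝ) (X : HermMat 𝕜 n) : (r • X).mat = r • X.mat := rfl

theorem mat_zero : (0 : HermMat 𝕜 n).mat = 0 := rfl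

instance [Fintype n] : FiniteDimensional ℝ (HermMat 𝕜 n) :=
  haveI : Module.Finite ℝ (Matrix n n 𝕜) := Module.Finite.trans 𝕜 _
  inferInstanceAs (FiniteDimensional ℝ (selfAdjoint.submodule ℝ (Matrix n n 𝕜)))

/-- The trace inner product `⟪X, Y⟫ = tr (X Y)`; the trace is real for Hermitian `X`, `Y`, see
`HermMat.inner_eq_trace`. -/
@[reducible]
def innerCore (𝕜 : Type*) [RCLike 𝕜] (n : Type*) [Fintype n] :
    InnerProductSpace.Core ℝ (HermMat 𝕜 n) where
  inner X Y := RCLike.re (Matrix.trace (X.mat * Y.mat))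
  conj_inner_symm X Y := by
    simp only [conj_trivial]
    rw [Matrix.trace_mul_comm]
  re_inner_nonneg X := by
    have h := X.isHermitian
    have h1 : 0 ≤ Matrix.trace (X.mat.conjTranspose * X.mat) :=
      (Matrix.posSemidef_conjTranspose_mul_self X.mat).trace_nonneg
    rw [h] at h1
    exact (RCLike.nonneg_iff.mp h1).1
  add_left X Y Z := by
    simp only [mat_add, add_mul, Matrix.trace_add, map_add]
  smul_left X Y r := by
    simp only [mat_smul, Matrix.smul_mul, Matrix.trace_smul, RCLike.smul_re, conj_trivial]
  definite X hX := by
    have h := X.isHermitian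
    have h1 : 0 ≤ Matrix.trace (X.mat.conjTranspose * X.mat) :=
      (Matrix.posSemidef_conjTranspose_mul_self X.mat).trace_nonneg
    have h2 : Matrix.trace (X.mat.conjTranspose * X.mat) = 0 := by
      rw [RCLike.nonneg_iff] at h1
      refine RCLike.ext ?_ ?_
      · rw [h]; simpa using hX
      · simpa using h1.2
    exact ext_mat (Matrix.trace_conjTranspose_mul_self_eq_zero_iff.mp h2)

instance [Fintype n] : NormedAddCommGroup (HermMat 𝕜 n) :=
  @InnerProductSpace.Core.toNormedAddCommGroup ℝ _ _ _ _ (innerCore 𝕜 n)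

instance [Fintype n] : InnerProductSpace ℝ (HermMat 𝕜 n) :=
  InnerProductSpace.ofCore (innerCore 𝕜 n).toCore

instance [Fintype n] : CompleteSpace (HermMat 𝕜 n) :=
  FiniteDimensional.complete ℝ _

theorem inner_def [Fintype n] (X Y : HermMat 𝕜 n) :
    ⟪X, Y⟫_ℝ = RCLike.re (Matrix.trace (X.mat * Y.mat)) := rfl

theorem inner_eq_trace [Fintype n] (X Y : HermMat 𝕜 n) :
    ((⟪X, Y⟫_ℝ : ℝ) : 𝕜) = Matrix.trace (X.mat * Y.mat) := by
  have h : star (Matrix.trace (X.mat * Y.mat)) = Matrix.trace (X.mat * Y.mat) := by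
    rw [← Matrix.trace_conjTranspose, Matrix.conjTranspose_mul, X.isHermitian, Y.isHermitian,
      Matrix.trace_mul_comm]
  rw [inner_def]
  exact RCLike.conj_eq_iff_re.mp h

/-- The nuclear (trace) norm `∑ₘ |eigₘ(X)|`. -/
def nuclearNorm [Fintype n] [DecidableEq n] (X : HermMat 𝕜 n) : ℝ :=
  ∑ m, |X.isHermitian.eigenvalues m|

end HermMat

namespace SemidefGame

variable {𝕜 : Type*} [RCLike 𝕜] {ι : Type*} {n : ι → Type*} [∀ i, Fintype (n i)]

/-- Action profiles (not yet required to be feasible): one Hermitian matrix for every player. -/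
abbrev Profile (𝕜 : Type*) [RCLike 𝕜] {ι : Type*} (n : ι → Type*) : Type _ :=
  ∀ i, HermMat 𝕜 (n i)

/-- The feasible actions `{X ≽ 0 : ‖X‖ ≤ A}` of one player, with the nuclear norm. -/
def feasible (𝕜 : Type*) [RCLike 𝕜] (m : Type*) [Fintype m] [DecidableEq m] (A : ℝ) :
    Set (HermMat 𝕜 m) :=
  {X | X.mat.PosSemidef ∧ X.nuclearNorm ≤ A}

variable [∀ i, DecidableEq (n i)]

/-- The feasible action profiles, i.e. the product of the players' feasible action sets. -/
def profiles (𝕜 : Type*) [RCLike 𝕜] {ι : Type*} (n : ι → Type*) [∀ i, Fintype (n i)]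
    [∀ i, DecidableEq (n i)] (A : ι → ℝ) : Set (Profile 𝕜 n) :=
  {X | ∀ i, X i ∈ feasible 𝕜 (n i) (A i)}

variable [DecidableEq ι]

/-- `X` is a Nash equilibrium of the game with bounds `A` and utilities `u`: it is feasible and no
player gains by a feasible unilateral deviation. -/
def IsNash (A : ι → ℝ) (u : ι → Profile 𝕜 n → ℝ) (X : Profile 𝕜 n) : Prop :=
  X ∈ profiles 𝕜 n A ∧
    ∀ i, ∀ Y ∈ feasible 𝕜 (n i) (A i), u i (Function.update X i Y) ≤ u i X

/-- The individual payoff gradient `Vᵢ(X) = ∇_{Xᵢ} uᵢ(Xᵢ; X₋ᵢ)`, with respect to the trace inner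
product; derivatives at boundary points are taken within the feasible set. -/
def payoffGrad (A : ι → ℝ) (u : ι → Profile 𝕜 n → ℝ) (i : ι) (X : Profile 𝕜 n) :
    HermMat 𝕜 (n i) :=
  gradientWithin (fun Y => u i (Function.update X i Y)) (feasible 𝕜 (n i) (A i)) (X i)

/-- The partial derivative of `Vᵢ` with respect to `Xⱼ`, as a linear map; derivatives at boundary
points are taken within the feasible set. -/
def gradDeriv (A : ι → ℝ) (u : ι → Profile 𝕜 n → ℝ) (i j : ι) (X : Profile 𝕜 n) :
    HermMat 𝕜 (n j) →L[ℝ] HermMat 𝕜 (n i) :=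
  fderivWithin ℝ (fun Y => payoffGrad A u i (Function.update X j Y))
    (feasible 𝕜 (n j) (A j)) (X j)

/-- The `(i, j)` block `½ ∇_{Xᵢ} ∇_{Xⱼ} uⱼ + ½ (∇_{Xⱼ} ∇_{Xᵢ} uᵢ)†` of the game's Hessian, as the
linear map that it defines from the `j`-th to the `i`-th component. The table
`∇_{Xᵢ} ∇_{Xⱼ} uⱼ = ∇_{Xᵢ} Vⱼ` has its rows indexed by `i`, so it is the adjoint of the derivative
of `Vⱼ` in `Xᵢ`; the second summand is the derivative of `Vᵢ` in `Xⱼ`. -/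
def hessianBlock (A : ι → ℝ) (u : ι → Profile 𝕜 n → ℝ) (i j : ι) (X : Profile 𝕜 n) :
    HermMat 𝕜 (n j) →L[ℝ] HermMat 𝕜 (n i) :=
  (1 / 2 : ℝ) • ContinuousLinearMap.adjoint (gradDeriv A u j i X) +
    (1 / 2 : ℝ) • gradDeriv A u i j X

variable [Fintype ι]

/-- `D(X) ≺ 0`: the quadratic form of the block matrix `D(X)` is negative definite. -/
def HessianNegDef (A : ι → ℝ) (u : ι → Profile 𝕜 n → ℝ) (X : Profile 𝕜 n) : Prop :=
  ∀ H : Profile 𝕜 n, H ≠ 0 → ∑ i, ∑ j, ⟪H i, hessianBlock A u i j X (H j)⟫_ℝ < 0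

/-- The trace pairing `tr[(X - X*) V(X)]` of block-diagonal matrices. -/
def stabilityPairing (A : ι → ℝ) (u : ι → Profile 𝕜 n → ℝ) (Xs X : Profile 𝕜 n) : ℝ :=
  ∑ i, ⟪X i - Xs i, payoffGrad A u i X⟫_ℝ

/-- The variational stability inequality for `X*` at `X`: `tr[(X - X*) V(X)] ≤ 0`, with equality
only if `X = X*`. -/
def VS (A : ι → ℝ) (u : ι → Profile 𝕜 n → ℝ) (Xs X : Profile 𝕜 n) : Prop :=
  stabilityPairing A u Xs X ≤ 0 ∧ (stabilityPairing A u Xs X = 0 → X = Xs)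

/-- `X*` is (locally) stable: the stability inequality holds at all feasible profiles close to
`X*`. -/
def IsLocallyStable (A : ι → ℝ) (u : ι → Profile 𝕜 n → ℝ) (Xs : Profile 𝕜 n) : Prop :=
  Xs ∈ profiles 𝕜 n A ∧ ∀ᶠ X in 𝓝[profiles 𝕜 n A] Xs, VS A u Xs X

/-- `X*` is globally stable: the stability inequality holds at all feasible profiles. -/
def IsGloballyStable (A : ι → ℝ) (u : ι → Profile 𝕜 n → ℝ) (Xs : Profile 𝕜 n) : Prop :=
  Xs ∈ profiles 𝕜 n A ∧ ∀ X ∈ profiles 𝕜 n A, VS A u Xs X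

/-- `X*` is isolated: it is the only Nash equilibrium in some neighbourhood of itself. -/
def IsIsolatedNash (A : ι → ℝ) (u : ι → Profile 𝕜 n → ℝ) (Xs : Profile 𝕜 n) : Prop :=
  IsNash A u Xs ∧ ∀ᶠ X in 𝓝 Xs, IsNash A u X → X = Xs

/-- The standing assumptions on the game: the bounds `Aᵢ` are positive, every `uᵢ` is concave and
differentiable in the player's own action, and the individual payoff gradients are continuously
differentiable on the set of feasible profiles, so that the Hessian exists and is continuous. -/
structure IsSmoothConcaveGame (A : ι → ℝ) (u : ι → Profile 𝕜 n → ℝ) : Prop where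
  pos : ∀ i, 0 < A i
  concave : ∀ i, ∀ X ∈ profiles 𝕜 n A,
    ConcaveOn ℝ (feasible 𝕜 (n i) (A i)) (fun Y => u i (Function.update X i Y))
  differentiable : ∀ i, ∀ X ∈ profiles 𝕜 n A,
    DifferentiableOn ℝ (fun Y => u i (Function.update X i Y)) (feasible 𝕜 (n i) (A i))
  contDiff : ∀ i, ContDiffOn ℝ 1 (payoffGrad A u i) (profiles 𝕜 n A)

end SemidefGame

end

/-!
The block matrix `D(X)` is the symmetric part of the derivative of the gradient field
`V = (V₁, …, V_N)`. If it is negative definite everywhere, the mean value theorem on segments makes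
`V` strictly monotone, `∑ᵢ ⟪Xᵢ - Yᵢ, Vᵢ(X) - Vᵢ(Y)⟫ < 0` for `X ≠ Y`; if it is negative definite at
`X*`, coercivity of the quadratic form gives the same inequality between `X*` and nearby profiles.
At an equilibrium `X*` the first-order condition reads `∑ᵢ ⟪Xᵢ - Xᵢ*, Vᵢ(X*)⟫ ≤ 0`, and adding it to
the monotonicity inequality yields the stability inequality. Conversely, the stability inequality
at another equilibrium `X` contradicts the first-order condition at `X`, hence uniqueness.

For existence, monotonicity and the minimax theorem give, for finitely many profiles `Y`, a profile
`X` with `∑ᵢ ⟪Yᵢ - Xᵢ, Vᵢ(Y)⟫ ≤ 0`; by compactness one `X` serves for all `Y`. Each utility then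
decreases along every segment of unilateral deviations from `X`, so `X` is an equilibrium.
-/

section VariationalInequality

variable {E : Type*} [AddCommGroup E] [Module ℝ E] [TopologicalSpace E]

theorem sum_mul_apply_sub_sum_smul_nonpos {κ : Type*} [Fintype κ] {w : κ → ℝ}
    (hw : w ∈ stdSimplex ℝ κ) {y : κ → E} {φ : κ → StrongDual ℝ E}
    (hφ : ∀ k j, (φ k - φ j) (y k - y j) ≤ 0) :
    ∑ k, w k * φ k (y k - ∑ j, w j • y j) ≤ 0 := by
  have hexpand : ∑ k, w k * φ k (y k - ∑ j, w j • y j) =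
      ∑ k, ∑ j, w k * w j * φ k (y k - y j) := by
    refine Finset.sum_congr rfl fun k _ => ?_
    have hbary : y k - ∑ j, w j • y j = ∑ j, w j • (y k - y j) := by
      simp only [smul_sub, Finset.sum_sub_distrib, ← Finset.sum_smul, hw.2, one_smul]
    simp only [hbary, map_sum, map_smul, smul_eq_mul, Finset.mul_sum, mul_assoc]
  have hsymm : 2 * ∑ k, ∑ j, w k * w j * φ k (y k - y j) =
      ∑ k, ∑ j, w k * w j * (φ k - φ j) (y k - y j) := by
    rw [two_mul]
    nth_rewrite 2 [Finset.sum_comm]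
    simp only [← Finset.sum_add_distrib]
    refine Finset.sum_congr rfl fun k _ => Finset.sum_congr rfl fun j _ => ?_
    rw [← neg_sub (y k) (y j), map_neg, sub_apply]
    ring
  have hnonpos : ∑ k, ∑ j, w k * w j * (φ k - φ j) (y k - y j) ≤ 0 :=
    Finset.sum_nonpos fun k _ => Finset.sum_nonpos fun j _ =>
      mul_nonpos_of_nonneg_of_nonpos (mul_nonneg (hw.1 k) (hw.1 j)) (hφ k j)
  linarith

variable [IsTopologicalAddGroup E] [ContinuousSMul ℝ E]

theorem exists_mem_convexHull_forall_apply_sub_nonpos {κ : Type*} [Finite κ] [Nonempty κ]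
    {y : κ → E} {φ : κ → StrongDual ℝ E} (hφ : ∀ k j, (φ k - φ j) (y k - y j) ≤ 0) :
    ∃ x ∈ convexHull ℝ (Set.range y), ∀ k, φ k (y k - x) ≤ 0 := by
  classical
  cases nonempty_fintype κ
  let f (x : E) (w : κ → ℝ) : ℝ := ∑ k, w k * φ k (y k - x)
  have hconvex (w : κ → ℝ) : ConvexOn ℝ (convexHull ℝ (Set.range y)) (f · w) := by
    refine ⟨convex_convexHull ℝ _, fun x _ z _ a b _ _ hab => le_of_eq ?_⟩
    simp only [f, map_sub, map_add, map_smul, smul_eq_mul, Finset.mul_sum,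
      ← Finset.sum_add_distrib]
    refine Finset.sum_congr rfl fun k _ => ?_
    linear_combination -(w k * φ k (y k)) * hab
  have hconcave (x : E) : ConcaveOn ℝ (stdSimplex ℝ κ) (f x) := by
    refine ⟨convex_stdSimplex ℝ κ, fun v _ w _ a b _ _ _ => le_of_eq ?_⟩
    simp only [f, Pi.add_apply, Pi.smul_apply, smul_eq_mul, Finset.mul_sum,
      ← Finset.sum_add_distrib]
    exact Finset.sum_congr rfl fun k _ => by ring
  obtain ⟨x, hx, w, hw, hsaddle⟩ := Sion.exists_isSaddlePointOn (f := f)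
    (Set.range_nonempty y).convexHull (convex_convexHull ℝ _)
    ((Set.finite_range y).isCompact_convexHull ℝ)
    (fun w _ => ContinuousOn.lowerSemicontinuousOn (by fun_prop))
    (fun w _ => (hconvex w).quasiconvexOn)
    (convex_stdSimplex ℝ κ) ⟨_, single_mem_stdSimplex ℝ (Classical.arbitrary κ)⟩
    (isCompact_stdSimplex ℝ κ)
    (fun x _ => ContinuousOn.upperSemicontinuousOn (by fun_prop))
    (fun x _ => (hconcave x).quasiconcaveOn)
  have hbary : ∑ j, w j • y j ∈ convexHull ℝ (Set.range y) :=
    (convex_convexHull ℝ _).sum_mem (fun j _ => hw.1 j) hw.2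
      fun j _ => subset_convexHull ℝ _ (Set.mem_range_self j)
  refine ⟨x, hx, fun k => ?_⟩
  calc φ k (y k - x) = f x (Pi.single k 1) := by simp [f, Pi.single_apply]
    _ ≤ f (∑ j, w j • y j) w := hsaddle _ hbary _ (single_mem_stdSimplex ℝ k)
    _ ≤ 0 := sum_mul_apply_sub_sum_smul_nonpos hw hφ

theorem exists_mem_forall_apply_sub_nonpos {K : Set E} (hK : IsCompact K) (hconv : Convex ℝ K)
    (hne : K.Nonempty) {F : E → StrongDual ℝ E}
    (hF : ∀ x ∈ K, ∀ y ∈ K, (F x - F y) (x - y) ≤ 0) :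
    ∃ x ∈ K, ∀ y ∈ K, F y (y - x) ≤ 0 := by
  suffices (K ∩ ⋂ y : K, {x | F y (y - x) ≤ 0}).Nonempty by
    simpa [Set.Nonempty, Set.mem_iInter] using this
  refine hK.inter_iInter_nonempty _
    (fun y => isClosed_le (by fun_prop) continuous_const) fun s => ?_
  rcases s.eq_empty_or_nonempty with rfl | hs
  · simpa using hne
  have : Nonempty s := hs.to_subtype
  obtain ⟨x, hx, hle⟩ := exists_mem_convexHull_forall_apply_sub_nonpos
    (y := fun k : s => ((k : K) : E)) (φ := fun k => F (k : K))
    fun k j => hF _ (k : K).2 _ (j : K).2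
  exact ⟨x, convexHull_min (Set.range_subset_iff.mpr fun k : s => (k : K).2) hconv hx,
    Set.mem_iInter₂.mpr fun y hy => hle ⟨y, hy⟩⟩

end VariationalInequality

section NegativeDefiniteDerivative

variable {E : Type*} [NormedAddCommGroup E] [NormedSpace ℝ E]

theorem isMaxOn_of_hasFDerivWithinAt_apply_sub_nonpos {s : Set E} {f : E → ℝ}
    {f' : E → StrongDual ℝ E} {x : E} (hs : StarConvex ℝ x s)
    (hf : ∀ y ∈ s, HasFDerivWithinAt f (f' y) s y) (hf' : ∀ y ∈ s, f' y (y - x) ≤ 0) :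
    IsMaxOn f s x := by
  intro y hy
  have hmaps : Set.MapsTo (AffineMap.lineMap x y : ℝ → E) (Set.Icc 0 1) s := by
    intro t ht
    rw [AffineMap.lineMap_apply_module', add_comm]
    exact hs.add_smul_sub_mem hy ht.1 ht.2
  have hderiv (t : ℝ) (ht : t ∈ Set.Icc (0 : ℝ) 1) :
      HasDerivWithinAt (f ∘ AffineMap.lineMap x y) (f' (AffineMap.lineMap x y t) (y - x))
        (Set.Icc 0 1) t :=
    (hf _ (hmaps ht)).comp_hasDerivWithinAt t AffineMap.hasDerivWithinAt_lineMap hmaps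
  have hanti : AntitoneOn (f ∘ AffineMap.lineMap (k := ℝ) x y) (Set.Icc 0 1) := by
    refine antitoneOn_of_hasDerivWithinAt_nonpos (convex_Icc 0 1)
      (fun t ht => (hderiv t ht).continuousWithinAt)
      (fun t ht => (hderiv t (interior_subset ht)).mono interior_subset) fun t ht => ?_
    rw [interior_Icc] at ht
    have hle := hf' _ (hmaps (Set.Ioo_subset_Icc_self ht))
    rw [AffineMap.lineMap_apply_module', add_sub_cancel_right, map_smul, smul_eq_mul] at hle
    exact nonpos_of_mul_nonpos_right hle ht.1
  simpa using hanti (by simp) (by simp) zero_le_one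

theorem sub_apply_sub_neg_of_hasFDerivWithinAt {K : Set E} (hK : Convex ℝ K)
    {F : E → StrongDual ℝ E} {F' : E → E →L[ℝ] StrongDual ℝ E}
    (hF : ∀ x ∈ K, HasFDerivWithinAt F (F' x) K x)
    (hneg : ∀ x ∈ K, ∀ h, h ≠ 0 → F' x h h < 0) {x y : E} (hx : x ∈ K) (hy : y ∈ K)
    (hxy : x ≠ y) : (F x - F y) (x - y) < 0 := by
  have hderiv (z : E) (hz : z ∈ K) : HasFDerivWithinAt (fun z => F z (x - y))
      ((ContinuousLinearMap.apply ℝ ℝ (x - y)).comp (F' z)) K z :=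
    (ContinuousLinearMap.apply ℝ ℝ (x - y)).hasFDerivAt.comp_hasFDerivWithinAt z (hF z hz)
  obtain ⟨z, hz, heq⟩ := domain_mvt hderiv hK hy hx
  calc (F x - F y) (x - y) = F' z (x - y) (x - y) := heq
    _ < 0 := hneg z (hK.segment_subset hy hx hz) _ (sub_ne_zero.mpr hxy)

theorem isCoercive_of_forall_pos [FiniteDimensional ℝ E] {B : E →L[ℝ] StrongDual ℝ E}
    (hB : ∀ h, h ≠ 0 → 0 < B h h) : IsCoercive B := by
  have : ProperSpace E := FiniteDimensional.proper_real E
  obtain ⟨c, hc, hle⟩ := (isCompact_sphere (0 : E) 1).exists_forall_le' (f := fun h => B h h)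
    (by fun_prop) fun h hh => hB h (ne_zero_of_mem_unit_sphere ⟨h, hh⟩)
  refine ⟨c, hc, fun h => ?_⟩
  rcases eq_or_ne h 0 with rfl | hh
  · simp
  have hnorm : ‖h‖ ≠ 0 := norm_ne_zero_iff.mpr hh
  calc c * ‖h‖ * ‖h‖ ≤ B (‖h‖⁻¹ • h) (‖h‖⁻¹ • h) * ‖h‖ * ‖h‖ := by
        gcongr
        exact hle _ (by simp [norm_smul, hnorm])
    _ = B h h := by
      simp only [map_smul, smul_apply, smul_eq_mul]
      field_simp

theorem eventually_sub_apply_sub_neg_of_hasFDerivWithinAt [FiniteDimensional ℝ E] {K : Set E}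
    {F : E → StrongDual ℝ E} {F' : E →L[ℝ] StrongDual ℝ E} {x : E}
    (hF : HasFDerivWithinAt F F' K x) (hneg : ∀ h, h ≠ 0 → F' h h < 0) :
    ∀ᶠ y in 𝓝[K] x, y ≠ x → (F y - F x) (y - x) < 0 := by
  obtain ⟨c, hc, hcoercive⟩ := isCoercive_of_forall_pos (B := -F') fun h hh => by
    simpa using hneg h hh
  filter_upwards [hF.isLittleO.def (half_pos hc)] with y hy hyx
  have hpos : 0 < ‖y - x‖ := norm_sub_pos_iff.mpr hyx
  have hmain : F' (y - x) (y - x) ≤ -(c * ‖y - x‖ * ‖y - x‖) := by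
    simpa using neg_le_neg (hcoercive (y - x))
  have hrem : (F y - F x - F' (y - x)) (y - x) ≤ c / 2 * ‖y - x‖ * ‖y - x‖ :=
    (le_abs_self _).trans (ContinuousLinearMap.le_of_opNorm_le _ hy _)
  calc (F y - F x) (y - x)
      = (F y - F x - F' (y - x)) (y - x) + F' (y - x) (y - x) := by simp
    _ ≤ c / 2 * ‖y - x‖ * ‖y - x‖ + -(c * ‖y - x‖ * ‖y - x‖) := add_le_add hrem hmain
    _ < 0 := by nlinarith [mul_pos hc (mul_pos hpos hpos)]

theorem uniqueDiffOn_of_convex_of_span_eq_top [FiniteDimensional ℝ E] {s : Set E}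
    (hs : Convex ℝ s) (h0 : 0 ∈ s) (hspan : Submodule.span ℝ s = ⊤) : UniqueDiffOn ℝ s := by
  refine uniqueDiffOn_convex hs (hs.interior_nonempty_iff_affineSpan_eq_top.mpr ?_)
  refine SetLike.coe_injective ?_
  rw [← Set.insert_eq_of_mem h0, affineSpan_insert_zero, hspan]
  rfl

end NegativeDefiniteDerivative

section PiInner

variable {ι : Type*} [Fintype ι] {F : ι → Type*} [∀ i, NormedAddCommGroup (F i)]
  [∀ i, InnerProductSpace ℝ (F i)]

/-- The pairing `(V, H) ↦ ∑ᵢ ⟪Vᵢ, Hᵢ⟫` on a product of inner product spaces, as a continuous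
bilinear form. The product type carries the supremum norm, so this is not an inner product on it. -/
noncomputable def piInner : (∀ i, F i) →L[ℝ] StrongDual ℝ (∀ i, F i) :=
  ∑ i, (ContinuousLinearMap.precomp ℝ (ContinuousLinearMap.proj i)) ∘L innerSL ℝ ∘L
    ContinuousLinearMap.proj i

theorem piInner_apply (V H : ∀ i, F i) : piInner V H = ∑ i, ⟪V i, H i⟫_ℝ := by
  simp only [piInner, sum_apply, ContinuousLinearMap.comp_apply,
    ContinuousLinearMap.precomp_apply, ContinuousLinearMap.proj_apply]
  rfl

end PiInner

noncomputable section

namespace HermMat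

variable {𝕜 : Type*} [RCLike 𝕜] {n : Type*}

/-- The identity matrix. -/
instance [DecidableEq n] : One (HermMat 𝕜 n) := ⟨⟨1, Matrix.isHermitian_one⟩⟩

theorem mat_one [DecidableEq n] : (1 : HermMat 𝕜 n).mat = 1 := rfl

theorem exists_posSemidef_sub_eq [Finite n] (X : HermMat 𝕜 n) :
    ∃ P Q : HermMat 𝕜 n, P.mat.PosSemidef ∧ Q.mat.PosSemidef ∧ P - Q = X := by
  classical
  cases nonempty_fintype n
  open scoped MatrixOrder in
  have hpos : (X.mat⁺).PosSemidef := Matrix.nonneg_iff_posSemidef.mp (CFC.posPart_nonneg X.mat)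
  have hneg : (X.mat⁻).PosSemidef := Matrix.nonneg_iff_posSemidef.mp (CFC.negPart_nonneg X.mat)
  exact ⟨⟨X.mat⁺, hpos.isHermitian⟩, ⟨X.mat⁻, hneg.isHermitian⟩, hpos, hneg,
    ext_mat (CFC.posPart_sub_negPart X.mat X.isHermitian)⟩

variable [Fintype n]

theorem continuous_mat : Continuous (mat : HermMat 𝕜 n → Matrix n n 𝕜) :=
  LinearMap.continuous_of_finiteDimensional
    (⟨⟨mat, mat_add⟩, mat_smul⟩ : HermMat 𝕜 n →ₗ[ℝ] Matrix n n 𝕜)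

variable [DecidableEq n]

theorem nuclearNorm_eq_inner_one {X : HermMat 𝕜 n} (hX : X.mat.PosSemidef) :
    X.nuclearNorm = ⟪1, X⟫_ℝ := by
  rw [inner_def, mat_one, one_mul, X.isHermitian.trace_eq_sum_eigenvalues]
  simp only [nuclearNorm, map_sum, RCLike.ofReal_re, abs_of_nonneg (hX.eigenvalues_nonneg _)]

theorem norm_sq_eq_sum_sq_eigenvalues (X : HermMat 𝕜 n) :
    ‖X‖ ^ 2 = ∑ m, X.isHermitian.eigenvalues m ^ 2 := by
  rw [← real_inner_self_eq_norm_sq, inner_def]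
  conv_lhs => rw [X.isHermitian.spectral_theorem, ← map_mul]
  rw [Unitary.conjStarAlgAut_apply, Matrix.diagonal_mul_diagonal, Matrix.trace_mul_cycle,
    Unitary.coe_star_mul_self, one_mul, Matrix.trace_diagonal]
  simp [pow_two]

theorem norm_le_nuclearNorm (X : HermMat 𝕜 n) : ‖X‖ ≤ X.nuclearNorm := by
  refine le_of_sq_le_sq ?_ (Finset.sum_nonneg fun _ _ => abs_nonneg _)
  rw [norm_sq_eq_sum_sq_eigenvalues]
  simpa only [nuclearNorm, sq_abs] using Finset.sum_sq_le_sq_sum_of_nonneg (s := Finset.univ)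
    fun m _ => abs_nonneg (X.isHermitian.eigenvalues m)

end HermMat

namespace SemidefGame

section Feasible

variable {𝕜 : Type*} [RCLike 𝕜] {m : Type*} [Fintype m] [DecidableEq m]

theorem mem_feasible_iff {A : ℝ} {X : HermMat 𝕜 m} :
    X ∈ feasible 𝕜 m A ↔ X.mat.PosSemidef ∧ ⟪1, X⟫_ℝ ≤ A :=
  and_congr_right fun hX => by rw [HermMat.nuclearNorm_eq_inner_one hX]

theorem zero_mem_feasible {A : ℝ} (hA : 0 ≤ A) : (0 : HermMat 𝕜 m) ∈ feasible 𝕜 m A := by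
  rw [mem_feasible_iff, inner_zero_right]
  exact ⟨Matrix.PosSemidef.zero, hA⟩

theorem convex_feasible (A : ℝ) : Convex ℝ (feasible 𝕜 m A) := by
  intro X hX Y hY a b ha hb hab
  rw [mem_feasible_iff] at *
  refine ⟨(hX.1.smul ha).add (hY.1.smul hb), ?_⟩
  rw [inner_add_right, real_inner_smul_right, real_inner_smul_right]
  exact (convex_Iic A) hX.2 hY.2 ha hb hab

theorem isClosed_feasible (A : ℝ) : IsClosed (feasible 𝕜 m A) := by
  have heq : feasible 𝕜 m A =
      (⋂ v : m → 𝕜, {X | 0 ≤ star v ⬝ᵥ X.mat.mulVec v}) ∩ {X | ⟪1, X⟫_ℝ ≤ A} := by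
    ext X
    simp [mem_feasible_iff, Matrix.posSemidef_iff_dotProduct_mulVec, X.isHermitian]
  rw [heq]
  exact (isClosed_iInter fun v => isClosed_le continuous_const
    (continuous_const.dotProduct (HermMat.continuous_mat.matrix_mulVec continuous_const))).inter
    (isClosed_le (by fun_prop) continuous_const)

theorem isCompact_feasible (A : ℝ) : IsCompact (feasible 𝕜 m A) := by
  have : ProperSpace (HermMat 𝕜 m) := FiniteDimensional.proper_real _
  refine Metric.isCompact_of_isClosed_isBounded (isClosed_feasible A)
    (Metric.isBounded_closedBall (x := (0 : HermMat 𝕜 m)) (r := A) |>.subset fun X hX => ?_)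
  exact mem_closedBall_zero_iff.mpr (X.norm_le_nuclearNorm.trans hX.2)

theorem mem_span_feasible_of_posSemidef {A : ℝ} (hA : 0 < A) {X : HermMat 𝕜 m}
    (hX : X.mat.PosSemidef) : X ∈ Submodule.span ℝ (feasible 𝕜 m A) := by
  have htr : 0 ≤ ⟪1, X⟫_ℝ := by
    rw [← HermMat.nuclearNorm_eq_inner_one hX]
    exact (norm_nonneg X).trans X.norm_le_nuclearNorm
  have hc : 0 < A / (1 + ⟪1, X⟫_ℝ) := by positivity
  have hmem : (A / (1 + ⟪1, X⟫_ℝ)) • X ∈ feasible 𝕜 m A := by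
    refine mem_feasible_iff.mpr ⟨hX.smul hc.le, ?_⟩
    rw [real_inner_smul_right, div_mul_eq_mul_div, div_le_iff₀ (by positivity)]
    nlinarith
  exact (Submodule.smul_mem_iff _ hc.ne').mp (Submodule.subset_span hmem)

theorem span_feasible {A : ℝ} (hA : 0 < A) : Submodule.span ℝ (feasible 𝕜 m A) = ⊤ := by
  refine eq_top_iff.mpr fun X _ => ?_
  obtain ⟨P, Q, hP, hQ, rfl⟩ := X.exists_posSemidef_sub_eq
  exact Submodule.sub_mem _ (mem_span_feasible_of_posSemidef hA hP)
    (mem_span_feasible_of_posSemidef hA hQ)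

theorem uniqueDiffOn_feasible {A : ℝ} (hA : 0 < A) : UniqueDiffOn ℝ (feasible 𝕜 m A) :=
  uniqueDiffOn_of_convex_of_span_eq_top (convex_feasible A) (zero_mem_feasible hA.le)
    (span_feasible hA)

end Feasible

section Game

variable {𝕜 : Type*} [RCLike 𝕜] {ι : Type*} {n : ι → Type*} [∀ i, Fintype (n i)]
  [∀ i, DecidableEq (n i)] {A : ι → ℝ}

theorem profiles_eq_pi (A : ι → ℝ) :
    profiles 𝕜 n A = Set.univ.pi fun i => feasible 𝕜 (n i) (A i) := by
  ext X
  simp [profiles]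

theorem convex_profiles (A : ι → ℝ) : Convex ℝ (profiles 𝕜 n A) := by
  rw [profiles_eq_pi]
  exact convex_pi fun i _ => convex_feasible (A i)

theorem isCompact_profiles (A : ι → ℝ) : IsCompact (profiles 𝕜 n A) := by
  rw [profiles_eq_pi]
  exact isCompact_univ_pi fun i => isCompact_feasible (A i)

variable [DecidableEq ι] {u : ι → Profile 𝕜 n → ℝ} {X Xs : Profile 𝕜 n}

theorem update_mem_profiles (hX : X ∈ profiles 𝕜 n A) {i : ι} {Y : HermMat 𝕜 (n i)}
    (hY : Y ∈ feasible 𝕜 (n i) (A i)) : Function.update X i Y ∈ profiles 𝕜 n A := by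
  rw [profiles_eq_pi] at *
  exact Set.update_mem_pi_iff_of_mem hX |>.mpr fun _ => hY

/-- The profile `V(X)` of all individual payoff gradients. -/
def gradField (A : ι → ℝ) (u : ι → Profile 𝕜 n → ℝ) (X : Profile 𝕜 n) : Profile 𝕜 n :=
  fun i => payoffGrad A u i X

theorem hasFDerivWithinAt_utility {i : ι}
    (hu : ∀ X ∈ profiles 𝕜 n A,
      DifferentiableOn ℝ (fun Y => u i (Function.update X i Y)) (feasible 𝕜 (n i) (A i)))
    (hX : X ∈ profiles 𝕜 n A) {Y : HermMat 𝕜 (n i)} (hY : Y ∈ feasible 𝕜 (n i) (A i)) :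
    HasFDerivWithinAt (fun Y => u i (Function.update X i Y))
      (InnerProductSpace.toDual ℝ _ (payoffGrad A u i (Function.update X i Y)))
      (feasible 𝕜 (n i) (A i)) Y := by
  have hgrad := (hu X hX Y hY).hasGradientWithinAt.hasFDerivWithinAt
  simpa only [payoffGrad, Function.update_idem, Function.update_self] using hgrad

theorem hasFDerivWithinAt_gradField [Finite ι]
    (hV : ∀ i, DifferentiableOn ℝ (payoffGrad A u i) (profiles 𝕜 n A))
    (hX : X ∈ profiles 𝕜 n A) :
    HasFDerivWithinAt (gradField A u) (fderivWithin ℝ (gradField A u) (profiles 𝕜 n A) X)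
      (profiles 𝕜 n A) X := by
  cases nonempty_fintype ι
  exact DifferentiableWithinAt.hasFDerivWithinAt (E := Profile 𝕜 n) (F := Profile 𝕜 n)
    (differentiableWithinAt_pi.mpr fun i => hV i X hX)

theorem gradDeriv_apply [Finite ι] (hA : ∀ i, 0 < A i)
    (hV : ∀ i, DifferentiableOn ℝ (payoffGrad A u i) (profiles 𝕜 n A))
    (hX : X ∈ profiles 𝕜 n A) (i j : ι) (H : HermMat 𝕜 (n j)) :
    gradDeriv A u i j X H =
      fderivWithin ℝ (gradField A u) (profiles 𝕜 n A) X (Pi.single j H) i := by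
  cases nonempty_fintype ι
  have hfield := hasFDerivWithinAt_pi'.mp (hasFDerivWithinAt_gradField hV hX) i
  rw [← Function.update_eq_self j X] at hfield
  have hcomp := hfield.comp (X j) (hasFDerivAt_update X (X j)).hasFDerivWithinAt
    (s := feasible 𝕜 (n j) (A j)) fun Y hY => update_mem_profiles hX hY
  rw [Function.update_eq_self] at hcomp
  have hsingle : ContinuousLinearMap.pi (Pi.single j (.id ℝ (HermMat 𝕜 (n j)))) H =
      (Pi.single j H : Profile 𝕜 n) := by
    ext k : 1
    exact Pi.apply_single (fun k (T : HermMat 𝕜 (n j) →L[ℝ] HermMat 𝕜 (n k)) => T H)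
      (fun _ => rfl) j _ k
  calc gradDeriv A u i j X H
      = fderivWithin ℝ (gradField A u) (profiles 𝕜 n A) X
          (ContinuousLinearMap.pi (Pi.single j (.id ℝ (HermMat 𝕜 (n j)))) H) i :=
        congrArg (· H) (hcomp.fderivWithin (uniqueDiffOn_feasible (hA j) (X j) (hX j)))
    _ = fderivWithin ℝ (gradField A u) (profiles 𝕜 n A) X (Pi.single j H) i := by rw [hsingle]

variable [Fintype ι]

theorem stabilityPairing_eq_piInner (Xs X : Profile 𝕜 n) :
    stabilityPairing A u Xs X = piInner (gradField A u X) (X - Xs) := by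
  rw [piInner_apply]
  simp only [stabilityPairing, gradField, Pi.sub_apply, real_inner_comm]

/-- The pairing `∑ᵢ ⟪Xᵢ - Yᵢ, Vᵢ(X) - Vᵢ(Y)⟫` that measures the monotonicity of the payoff
gradients. -/
def monotonicityPairing (A : ι → ℝ) (u : ι → Profile 𝕜 n → ℝ) (X Y : Profile 𝕜 n) : ℝ :=
  ∑ i, ⟪X i - Y i, payoffGrad A u i X - payoffGrad A u i Y⟫_ℝ

/-- Strictly monotone games, i.e. those with Rosen's diagonal strict concavity property. -/
def IsStrictlyMonotone (A : ι → ℝ) (u : ι → Profile 𝕜 n → ℝ) : Prop :=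
  ∀ X ∈ profiles 𝕜 n A, ∀ Y ∈ profiles 𝕜 n A, X ≠ Y → monotonicityPairing A u X Y < 0

theorem monotonicityPairing_eq_piInner (X Y : Profile 𝕜 n) :
    monotonicityPairing A u X Y =
      (piInner (gradField A u X) - piInner (gradField A u Y)) (X - Y) := by
  rw [← map_sub, piInner_apply]
  simp only [monotonicityPairing, gradField, Pi.sub_apply, real_inner_comm]

theorem monotonicityPairing_eq_add (X Y : Profile 𝕜 n) :
    monotonicityPairing A u X Y = stabilityPairing A u Y X + stabilityPairing A u X Y := by
  simp only [monotonicityPairing, stabilityPairing, ← Finset.sum_add_distrib]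
  refine Finset.sum_congr rfl fun i _ => ?_
  rw [inner_sub_right, ← neg_sub (X i) (Y i), inner_neg_left, sub_eq_add_neg]

theorem IsStrictlyMonotone.monotonicityPairing_nonpos (hmono : IsStrictlyMonotone A u)
    (hX : X ∈ profiles 𝕜 n A) {Y : Profile 𝕜 n} (hY : Y ∈ profiles 𝕜 n A) :
    monotonicityPairing A u X Y ≤ 0 := by
  rcases eq_or_ne X Y with rfl | hne
  · simp [monotonicityPairing]
  · exact (hmono X hX Y hY hne).le

section FirstOrderCondition

variable (hu : ∀ i, ∀ X ∈ profiles 𝕜 n A,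
  DifferentiableOn ℝ (fun Y => u i (Function.update X i Y)) (feasible 𝕜 (n i) (A i)))
include hu

theorem IsNash.stabilityPairing_nonneg (hX : IsNash A u X) (hXs : Xs ∈ profiles 𝕜 n A) :
    0 ≤ stabilityPairing A u Xs X := by
  refine Finset.sum_nonneg fun i _ => ?_
  have hmax : IsMaxOn (fun Y => u i (Function.update X i Y)) (feasible 𝕜 (n i) (A i)) (X i) :=
    fun Y hY => by simpa using hX.2 i Y hY
  have hle := hmax.localize.hasFDerivWithinAt_nonpos
    (hasFDerivWithinAt_utility (hu i) hX.1 (hX.1 i))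
    (sub_mem_posTangentConeAt_of_segment_subset
      ((convex_feasible (A i)).segment_subset (hX.1 i) (hXs i)))
  rw [Function.update_eq_self, InnerProductSpace.toDual_apply_apply,
    real_inner_comm, ← neg_sub, inner_neg_left] at hle
  exact neg_nonpos.mp hle

theorem isNash_of_forall_stabilityPairing_nonpos (hXs : Xs ∈ profiles 𝕜 n A)
    (hle : ∀ X ∈ profiles 𝕜 n A, stabilityPairing A u Xs X ≤ 0) : IsNash A u Xs := by
  refine ⟨hXs, fun i Y hY => ?_⟩
  have hmax := isMaxOn_of_hasFDerivWithinAt_apply_sub_nonpos (E := HermMat 𝕜 (n i))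
    (f' := fun Y => InnerProductSpace.toDual ℝ _ (payoffGrad A u i (Function.update Xs i Y)))
    ((convex_feasible (A i)).starConvex (hXs i))
    (fun Y hY => hasFDerivWithinAt_utility (hu i) hXs hY) fun Y hY => ?_
  · simpa using hmax hY
  · rw [InnerProductSpace.toDual_apply_apply]
    have h := hle _ (update_mem_profiles hXs hY)
    rw [stabilityPairing, Finset.sum_eq_single i (fun j _ hj => by simp [hj]) (by simp)] at h
    rwa [Function.update_self, real_inner_comm] at h

theorem exists_isNash_of_forall_monotonicityPairing_nonpos (hA : ∀ i, 0 ≤ A i)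
    (hmono : ∀ X ∈ profiles 𝕜 n A, ∀ Y ∈ profiles 𝕜 n A, monotonicityPairing A u X Y ≤ 0) :
    ∃ Xs, IsNash A u Xs := by
  simp only [monotonicityPairing_eq_piInner] at hmono
  obtain ⟨Xs, hXs, hle⟩ := exists_mem_forall_apply_sub_nonpos (E := Profile 𝕜 n)
    (isCompact_profiles A) (convex_profiles A) ⟨0, fun i => zero_mem_feasible (hA i)⟩ hmono
  exact ⟨Xs, isNash_of_forall_stabilityPairing_nonpos hu hXs fun X hX =>
    (stabilityPairing_eq_piInner Xs X).trans_le (hle X hX)⟩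

theorem IsNash.eq_of_vs (hX : IsNash A u X) (hXs : Xs ∈ profiles 𝕜 n A) (hvs : VS A u Xs X) :
    X = Xs :=
  hvs.2 (hvs.1.antisymm (hX.stabilityPairing_nonneg hu hXs))

theorem IsNash.vs_of_monotonicityPairing_neg (hXs : IsNash A u Xs) (hX : X ∈ profiles 𝕜 n A)
    (hmono : X ≠ Xs → monotonicityPairing A u X Xs < 0) : VS A u Xs X := by
  rcases eq_or_ne X Xs with rfl | hne
  · simp [VS, stabilityPairing]
  · have hlt := hmono hne
    rw [monotonicityPairing_eq_add] at hlt
    have hneg : stabilityPairing A u Xs X < 0 := by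
      linarith [hXs.stabilityPairing_nonneg hu hX]
    exact ⟨hneg.le, fun hzero => absurd hzero hneg.ne⟩

theorem IsNash.isGloballyStable_of_isStrictlyMonotone (hXs : IsNash A u Xs)
    (hmono : IsStrictlyMonotone A u) : IsGloballyStable A u Xs :=
  ⟨hXs.1, fun X hX => hXs.vs_of_monotonicityPairing_neg hu hX (hmono X hX Xs hXs.1)⟩

theorem IsNash.isLocallyStable_of_eventually_monotonicityPairing_neg (hXs : IsNash A u Xs)
    (hmono : ∀ᶠ X in 𝓝[profiles 𝕜 n A] Xs, X ≠ Xs → monotonicityPairing A u X Xs < 0) :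
    IsLocallyStable A u Xs := by
  refine ⟨hXs.1, ?_⟩
  filter_upwards [hmono, self_mem_nhdsWithin] with X hlt hX
  exact hXs.vs_of_monotonicityPairing_neg hu hX hlt

theorem IsNash.isIsolatedNash_of_isLocallyStable
    (hXs : IsNash A u Xs) (hstable : IsLocallyStable A u Xs) : IsIsolatedNash A u Xs := by
  refine ⟨hXs, ?_⟩
  filter_upwards [eventually_nhdsWithin_iff.mp hstable.2] with X hvs hX
  exact hX.eq_of_vs hu hXs.1 (hvs hX.1)

end FirstOrderCondition

theorem hasFDerivWithinAt_piInner_gradField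
    (hV : ∀ i, DifferentiableOn ℝ (payoffGrad A u i) (profiles 𝕜 n A))
    (hX : X ∈ profiles 𝕜 n A) :
    HasFDerivWithinAt (fun Y => piInner (gradField A u Y))
      (piInner ∘L fderivWithin ℝ (gradField A u) (profiles 𝕜 n A) X) (profiles 𝕜 n A) X :=
  HasFDerivAt.comp_hasFDerivWithinAt (E := Profile 𝕜 n) (F := Profile 𝕜 n)
    (G := StrongDual ℝ (Profile 𝕜 n)) X
    (piInner (F := fun i => HermMat 𝕜 (n i))).hasFDerivAt (hasFDerivWithinAt_gradField hV hX)

section Hessian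

variable (hA : ∀ i, 0 < A i)
  (hV : ∀ i, DifferentiableOn ℝ (payoffGrad A u i) (profiles 𝕜 n A))
include hA hV

theorem sum_inner_hessianBlock (hX : X ∈ profiles 𝕜 n A) (H : Profile 𝕜 n) :
    ∑ i, ∑ j, ⟪H i, hessianBlock A u i j X (H j)⟫_ℝ =
      piInner (fderivWithin ℝ (gradField A u) (profiles 𝕜 n A) X H) H := by
  have hswap : ∑ i, ∑ j, ⟪gradDeriv A u j i X (H i), H j⟫_ℝ =
      ∑ i, ∑ j, ⟪H i, gradDeriv A u i j X (H j)⟫_ℝ := by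
    rw [Finset.sum_comm]
    simp only [real_inner_comm]
  have hderiv (i : ι) : ∑ j, gradDeriv A u i j X (H j) =
      fderivWithin ℝ (gradField A u) (profiles 𝕜 n A) X H i := by
    conv_rhs => rw [← Finset.univ_sum_single H, map_sum, Finset.sum_apply]
    simp only [gradDeriv_apply hA hV hX]
  simp only [hessianBlock, add_apply, smul_apply, inner_add_right, real_inner_smul_right,
    ContinuousLinearMap.adjoint_inner_right, Finset.sum_add_distrib, ← Finset.mul_sum]
  rw [hswap, ← add_mul, add_halves, one_mul, piInner_apply]
  simp only [← inner_sum, hderiv, real_inner_comm]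

theorem isStrictlyMonotone_of_hessianNegDef
    (hneg : ∀ X ∈ profiles 𝕜 n A, HessianNegDef A u X) : IsStrictlyMonotone A u := by
  intro X hX Y hY hne
  rw [monotonicityPairing_eq_piInner]
  refine sub_apply_sub_neg_of_hasFDerivWithinAt (E := Profile 𝕜 n) (convex_profiles A)
    (fun Z hZ => hasFDerivWithinAt_piInner_gradField hV hZ) (fun Z hZ H hH => ?_) hX hY hne
  exact (sum_inner_hessianBlock hA hV hZ H).symm.trans_lt (hneg Z hZ H hH)

theorem HessianNegDef.eventually_monotonicityPairing_neg (hneg : HessianNegDef A u Xs)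
    (hXs : Xs ∈ profiles 𝕜 n A) :
    ∀ᶠ X in 𝓝[profiles 𝕜 n A] Xs, X ≠ Xs → monotonicityPairing A u X Xs < 0 := by
  simp only [monotonicityPairing_eq_piInner]
  refine eventually_sub_apply_sub_neg_of_hasFDerivWithinAt (E := Profile 𝕜 n)
    (hasFDerivWithinAt_piInner_gradField hV hXs) fun H hH => ?_
  exact (sum_inner_hessianBlock hA hV hXs H).symm.trans_lt (hneg H hH)

end Hessian

end Game

end SemidefGame

end

theorem mainTheorem8_general {𝕜 : Type*} [RCLike 𝕜] {ι : Type*} [Fintype ι] [DecidableEq ι]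
    {n : ι → Type*} [∀ i, Fintype (n i)] [∀ i, DecidableEq (n i)]
    (A : ι → ℝ) (u : ι → SemidefGame.Profile 𝕜 n → ℝ) (hA : ∀ i, 0 < A i)
    (hu : ∀ i, ∀ X ∈ SemidefGame.profiles 𝕜 n A,
      DifferentiableOn ℝ (fun Y => u i (Function.update X i Y))
        (SemidefGame.feasible 𝕜 (n i) (A i)))
    (hV : ∀ i,
      DifferentiableOn ℝ (SemidefGame.payoffGrad A u i) (SemidefGame.profiles 𝕜 n A)) :
    ((∀ X ∈ SemidefGame.profiles 𝕜 n A, SemidefGame.HessianNegDef A u X) →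
      ∃ Xs : SemidefGame.Profile 𝕜 n, SemidefGame.IsNash A u Xs ∧
        (∀ X, SemidefGame.IsNash A u X → X = Xs) ∧ SemidefGame.IsGloballyStable A u Xs) ∧
    (∀ Xs : SemidefGame.Profile 𝕜 n, SemidefGame.IsNash A u Xs →
      SemidefGame.HessianNegDef A u Xs →
        SemidefGame.IsLocallyStable A u Xs ∧ SemidefGame.IsIsolatedNash A u Xs) := by
  open SemidefGame in
  refine ⟨fun hneg => ?_, fun Xs hXs hneg => ?_⟩
  · have hmono : IsStrictlyMonotone A u := isStrictlyMonotone_of_hessianNegDef hA hV hneg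
    obtain ⟨Xs, hXs⟩ := exists_isNash_of_forall_monotonicityPairing_nonpos hu
      (fun i => (hA i).le) fun X hX Y hY => hmono.monotonicityPairing_nonpos hX hY
    have hstable : IsGloballyStable A u Xs := hXs.isGloballyStable_of_isStrictlyMonotone hu hmono
    exact ⟨Xs, hXs, fun X hX => hX.eq_of_vs hu hXs.1 (hstable.2 X hX.1), hstable⟩
  · have hstable : IsLocallyStable A u Xs :=
      hXs.isLocallyStable_of_eventually_monotonicityPairing_neg hu
        (hneg.eventually_monotonicityPairing_neg hA hV hXs.1)
    exact ⟨hstable, hXs.isIsolatedNash_of_isLocallyStable hu hstable⟩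

theorem mainTheorem8 {𝕜 : Type*} [RCLike 𝕜] {ι : Type*} [Fintype ι] [DecidableEq ι]
    {n : ι → Type*} [∀ i, Fintype (n i)] [∀ i, DecidableEq (n i)]
    (A : ι → ℝ) (u : ι → SemidefGame.Profile 𝕜 n → ℝ)
    (hgame : SemidefGame.IsSmoothConcaveGame A u) :
    ((∀ X ∈ SemidefGame.profiles 𝕜 n A, SemidefGame.HessianNegDef A u X) →
      ∃ Xs : SemidefGame.Profile 𝕜 n, SemidefGame.IsNash A u Xs ∧
        (∀ X, SemidefGame.IsNash A u X → X = Xs) ∧ SemidefGame.IsGloballyStable A u Xs) ∧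
    (∀ Xs : SemidefGame.Profile 𝕜 n, SemidefGame.IsNash A u Xs →
      SemidefGame.HessianNegDef A u Xs →
        SemidefGame.IsLocallyStable A u Xs ∧ SemidefGame.IsIsolatedNash A u Xs) :=
  mainTheorem8_general A u hgame.pos hgame.differentiable
    fun i => (hgame.contDiff i).differentiableOn one_ne_zero
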